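/- Theorem. An entire function is called transcendental if it is not a polynomial. For an entire function $g$ let $g^n$ denote its $n$-th iterate, and let the Fatou set $F(g)$ be the set of all $z\in\mathbb{C}$ that have an open connected neighbourhood on which the family $\{g^n\}_{n\in\mathbb{N}}$ is normal, i.e. on which every sequence of members of the family has a subsequence that converges locally uniformly either to a holomorphic function or to $\infty$. Let $g$ and $h$ be transcendental entire functions, and let $f:\mathbb{C}\to\mathbb{C}$ be a continuous open map with $f\circ g=h\circ f$. Suppose that $f$ omits two values in the complement of the closure of each disk, that is, for every open disk $D\subset\mathbb{C}$ there are two distinct numbers $a,b\in\mathbb{C}$ (which may depend on $D$) such that $f(z)\neq a$ and $f(z)\neq b$ for all $z\in\mathbb{C}\setminus\overline{D}$. Then $f(F(g))\subset F(h)$. -/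

import Mathlib

open Filter Topology

/-- A transcendental entire function: holomorphic on the whole plane and not a polynomial. -/
structure IsTranscendentalEntire (g : ℂ → ℂ) : Prop where
  entire : Differentiable ℂ g
  not_polynomial : ¬ ∃ P : Polynomial ℂ, ∀ z : ℂ, g z = P.eval z

/-- The sequence `F` tends to `∞` uniformly on every compact subset of `U`. -/
def TendstoInftyLocallyUniformlyOn (F : ℕ → ℂ → ℂ) (U : Set ℂ) : Prop :=
  ∀ K : Set ℂ, K ⊆ U → IsCompact K → ∀ R : ℝ, ∀ᶠ k in atTop, ∀ z ∈ K, R < ‖F k z‖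

/-- Normality (in the sense of Montel) of a family of holomorphic functions on a plane domain `U`:
every sequence of members of the family has a subsequence that converges locally uniformly on `U`,
either to a holomorphic function or to `∞`. -/
def IsNormalFamilyOn {ι : Type*} (F : ι → ℂ → ℂ) (U : Set ℂ) : Prop :=
  ∀ s : ℕ → ι, ∃ φ : ℕ → ℕ, StrictMono φ ∧
    ((∃ G : ℂ → ℂ, DifferentiableOn ℂ G U ∧
        TendstoLocallyUniformlyOn (fun k => F (s (φ k))) G atTop U) ∨
      TendstoInftyLocallyUniformlyOn (fun k => F (s (φ k))) U)

/-- The Fatou set: the points with an open connected neighbourhood on which the iterates of `g`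
form a normal family. -/
def fatouSet (g : ℂ → ℂ) : Set ℂ :=
  {z | ∃ U : Set ℂ, IsOpen U ∧ IsConnected U ∧ z ∈ U ∧ IsNormalFamilyOn (fun n : ℕ => g^[n]) U}

/-- `f` omits two values in the complement of the closure of each disk: for every open disk `D`
there are two distinct numbers (which may depend on `D`) that `f` does not take outside the
closure of `D`. -/
def OmitsTwoValuesOutsideDisks (f : ℂ → ℂ) : Prop :=
  ∀ (c : ℂ) (r : ℝ), 0 < r → ∃ a b : ℂ, a ≠ b ∧
    ∀ z ∈ (closure (Metric.ball c r))ᶜ, f z ≠ a ∧ f z ≠ b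

/-! The semiconjugacy gives `h^[n] ∘ f = f ∘ g^[n]`, and openness of `f` makes the image of a small
disk about `z` a neighbourhood of `f z`. If iterates of `g` converge to a holomorphic `G`, then `f ∘
g^[n]` converges uniformly to `f ∘ G` near `z`, so the same iterates of `h` converge uniformly near
`f z`. If they tend to `∞`, they eventually map the disk outside the closed unit disk, where `f`
omits two values; so `h^[n]` omits these values near `f z`, and Montel's test applies. Montel's test
rests on Schottky's theorem: a function omitting 0 and 1 is `exp (π i (1 + cosh H))`, where `H`
misses a relatively dense set, so Bloch's theorem bounds `H'`. -/

/-! ### Holomorphic logarithms and Bloch's theorem. -/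

open Metric Complex in
/-- A zero-free holomorphic function on a disk has a holomorphic logarithm, which may be chosen to
agree with the principal branch at the centre. -/
theorem exists_differentiableOn_exp_eq {c : ℂ} {r : ℝ} (hr : 0 < r) {f : ℂ → ℂ}
    (hf : DifferentiableOn ℂ f (ball c r)) (h0 : ∀ z ∈ ball c r, f z ≠ 0) :
    ∃ l : ℂ → ℂ, DifferentiableOn ℂ l (ball c r) ∧ (∀ z ∈ ball c r, exp (l z) = f z) ∧
      l c = log (f c) := by
  have hc : c ∈ ball c r := mem_ball_self hr
  have hd : DifferentiableOn ℂ (fun z => deriv f z / f z) (ball c r) :=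
    (hf.deriv isOpen_ball).div hf h0
  obtain ⟨l, hl, hlc⟩ := hd.isExactOn_ball.with_val_at c (log (f c))
  refine ⟨l, fun z hz => (hlc z hz).differentiableAt.differentiableWithinAt, ?_, hl⟩
  have hq : ∀ z ∈ ball c r, HasDerivAt (fun z => f z * exp (-l z)) 0 z := by
    intro z hz
    have h1 := (hf.differentiableAt (isOpen_ball.mem_nhds hz)).hasDerivAt
    have h2 : HasDerivAt (fun z => f z * exp (-l z))
        (deriv f z * exp (-l z) + f z * (exp (-l z) * -(deriv f z / f z))) z :=
      h1.mul (hlc z hz).neg.cexp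
    have h3 : deriv f z * exp (-l z) + f z * (exp (-l z) * -(deriv f z / f z)) = 0 := by
      have := h0 z hz
      field_simp
      ring
    rwa [h3] at h2
  intro z hz
  have hconst := isOpen_ball.is_const_of_deriv_eq_zero (convex_ball c r).isPreconnected
    (fun w hw => (hq w hw).differentiableAt.differentiableWithinAt)
    (fun w hw => (hq w hw).deriv) hz hc
  simp only [hl, Complex.exp_neg, exp_log (h0 c hc)] at hconst
  rw [mul_inv_cancel₀ (h0 c hc)] at hconst
  field_simp [Complex.exp_ne_zero] at hconst
  exact hconst.symm

open Metric in
/-- If `f'` does not exceed twice the modulus of its value at the centre of a disk, then the image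
of the disk contains a disk of comparable size. -/
theorem exists_ball_subset_image_of_norm_deriv_le {p : ℂ} {t : ℝ} (ht : 0 < t) {f : ℂ → ℂ}
    (hf : DifferentiableOn ℂ f (ball p t)) (hp : deriv f p ≠ 0)
    (hb : ∀ z ∈ ball p t, ‖deriv f z‖ ≤ 2 * ‖deriv f p‖) :
    ball (f p) (‖deriv f p‖ * t / 24) ⊆ f '' ball p t := by
  set a := ‖deriv f p‖ with ha
  have ha0 : 0 < a := norm_pos_iff.2 hp
  -- The Schwarz lemma gives `‖f' z - f' p‖ ≤ (3a/t) ‖z - p‖`, which is at most `a/2` on radius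
  -- `t/6`. Hence `‖f z - f p‖ ≥ at/12` on the boundary circle, and half of this is the radius
  -- `at/24`.
  have hsub : closedBall p (t / 6) ⊆ ball p t := closedBall_subset_ball (by linarith)
  have hmaps : Set.MapsTo (deriv f) (ball p t) (closedBall (deriv f p) (3 * a)) := by
    intro z hz
    rw [mem_closedBall, dist_eq_norm]
    linarith [norm_sub_le (deriv f z) (deriv f p), hb z hz]
  have hder : ∀ z ∈ closedBall p (t / 6), ‖deriv f z - deriv f p‖ ≤ a / 2 := by
    intro z hz
    have h1 := Complex.dist_le_div_mul_dist_of_mapsTo_ball (hf.deriv isOpen_ball) hmaps (hsub hz)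
    rw [dist_eq_norm] at h1
    refine h1.trans ?_
    calc 3 * a / t * dist z p ≤ 3 * a / t * (t / 6) := by gcongr; exact hz
      _ = a / 2 := by field_simp; norm_num
  have hlin : ∀ z ∈ closedBall p (t / 6), ‖f z - f p - deriv f p * (z - p)‖ ≤ a / 2 * ‖z - p‖ := by
    intro z hz
    have := (convex_closedBall p (t / 6)).norm_image_sub_le_of_norm_hasDerivWithin_le
      (f := fun z => f z - deriv f p * z) (f' := fun z => deriv f z - deriv f p) (C := a / 2)
      (fun w hw => ((hf.differentiableAt (isOpen_ball.mem_nhds (hsub hw))).hasDerivAt.sub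
        (by simpa using (hasDerivAt_id w).const_mul (deriv f p))).hasDerivWithinAt)
      hder (mem_closedBall_self (by positivity)) hz
    rwa [show f z - f p - deriv f p * (z - p) = f z - deriv f p * z - (f p - deriv f p * p) by ring]
  have hlow : ∀ z ∈ closedBall p (t / 6), a / 2 * ‖z - p‖ ≤ ‖f z - f p‖ := by
    intro z hz
    have h1 := hlin z hz
    have h2 := norm_sub_norm_le (deriv f p * (z - p)) (f z - f p)
    rw [norm_sub_rev (deriv f p * (z - p)), norm_mul, ← ha] at h2
    linarith
  have key : ball (f p) (a * t / 12 / 2) ⊆ f '' closedBall p (t / 6) := by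
    refine DiffContOnCl.ball_subset_image_closedBall ?_ (by positivity) ?_ ?_
    · exact (hf.mono hsub).diffContOnCl_ball subset_rfl
    · intro z hz
      have := hlow z (sphere_subset_closedBall hz)
      rw [mem_sphere, dist_eq_norm] at hz
      rw [hz] at this
      linarith
    · refine Eventually.frequently (f := 𝓝[≠] p) ?_ |>.filter_mono nhdsWithin_le_nhds
      have : closedBall p (t / 6) ∈ 𝓝[≠] p :=
        nhdsWithin_le_nhds (closedBall_mem_nhds p (by positivity))
      filter_upwards [this, self_mem_nhdsWithin] with z hz hne heq
      have := hlow z hz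
      rw [heq, sub_self, norm_zero] at this
      have : 0 < ‖z - p‖ := norm_pos_iff.2 (sub_ne_zero.2 hne)
      nlinarith
  calc _ = ball (f p) (a * t / 12 / 2) := by congr 1; ring
    _ ⊆ _ := key
    _ ⊆ _ := Set.image_mono hsub

open Metric in
/-- **Bloch's theorem**, with a non-optimal constant. -/
theorem exists_ball_subset_image_ball {c : ℂ} {r R : ℝ} (hr : 0 < r) (hrR : r < R) {f : ℂ → ℂ}
    (hf : DifferentiableOn ℂ f (ball c R)) :
    ∃ w : ℂ, ball w (‖deriv f c‖ * r / 48) ⊆ f '' ball c R := by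
  by_cases h0 : deriv f c = 0
  · exact ⟨0, by simp [h0]⟩
  have hsub : closedBall c r ⊆ ball c R := closedBall_subset_ball hrR
  have hcont : ContinuousOn (fun z => ‖deriv f z‖ * (r - dist z c)) (closedBall c r) :=
    ((hf.deriv isOpen_ball).continuousOn.mono hsub).norm.mul (by fun_prop)
  -- Maximality at `p` gives `‖f'‖ ≤ 2‖f' p‖` on the disk about `p` whose radius `t` is half of `r -
  -- dist p c`, while `‖f' p‖ t ≥ ‖f' c‖ r / 2`; hence 48 = 2 · 24.
  obtain ⟨p, hp, hmax⟩ := (isCompact_closedBall c r).exists_isMaxOn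
    (nonempty_closedBall.2 hr.le) hcont
  have hmax' : ∀ z ∈ closedBall c r,
      ‖deriv f z‖ * (r - dist z c) ≤ ‖deriv f p‖ * (r - dist p c) := hmax
  have hpc := hmax' c (mem_closedBall_self hr.le)
  rw [dist_self, sub_zero] at hpc
  have hpos : 0 < ‖deriv f p‖ * (r - dist p c) :=
    lt_of_lt_of_le (mul_pos (norm_pos_iff.2 h0) hr) hpc
  have hp0 : 0 < ‖deriv f p‖ := by
    rcases (norm_nonneg (deriv f p)).eq_or_lt with h | h
    · rw [← h] at hpos; simp at hpos
    · exact h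
  have hd : 0 < r - dist p c := pos_of_mul_pos_right hpos hp0.le
  set t := (r - dist p c) / 2 with ht
  have hin : ∀ z ∈ ball p t, t ≤ r - dist z c := by
    intro z hz
    have := dist_triangle z p c
    rw [mem_ball] at hz
    linarith
  have hball : ball p t ⊆ closedBall c r := fun z hz => by
    have := hin z hz
    rw [mem_closedBall]
    linarith
  refine ⟨f p, ?_⟩
  have := exists_ball_subset_image_of_norm_deriv_le (p := p) (t := t) (by positivity)
    (hf.mono (hball.trans hsub)) (norm_pos_iff.1 hp0) ?_
  · refine (ball_subset_ball ?_).trans (this.trans (Set.image_mono (hball.trans hsub)))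
    rw [ht]
    linarith
  · intro z hz
    have h1 := hmax' z (hball hz)
    have h2 := mul_le_mul_of_nonneg_left (hin z hz) (norm_nonneg (deriv f z))
    have ht0 : 0 < t := by positivity
    have h3 : ‖deriv f p‖ * (r - dist p c) = 2 * ‖deriv f p‖ * t := by rw [ht]; ring
    refine le_of_mul_le_mul_right ?_ ht0
    linarith

/-! ### Montel's theorem for bounded sequences. -/

open Metric in
/-- **Montel's theorem** for uniformly bounded sequences on a disk. -/
theorem exists_subseq_tendstoLocallyUniformlyOn_of_bounded {c : ℂ} {r M : ℝ} (hr : 0 < r)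
    {F : ℕ → ℂ → ℂ} (hF : ∀ k, DifferentiableOn ℂ (F k) (ball c r))
    (hM : ∀ k, ∀ z ∈ ball c r, ‖F k z‖ ≤ M) :
    ∃ φ : ℕ → ℕ, StrictMono φ ∧ ∃ G : ℂ → ℂ, DifferentiableOn ℂ G (ball c (r / 2)) ∧
      TendstoLocallyUniformlyOn (fun k => F (φ k)) G atTop (ball c (r / 2)) := by
  have hsub : closedBall c (r / 2) ⊆ ball c r := closedBall_subset_ball (by linarith)
  have : CompactSpace (closedBall c (r / 2)) :=
    isCompact_iff_compactSpace.1 (isCompact_closedBall c (r / 2))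
  let B : ℕ → BoundedContinuousFunction (closedBall c (r / 2)) ℂ := fun k =>
    BoundedContinuousFunction.mkOfCompact
      ⟨fun x => F k x, ((hF k).continuousOn.mono hsub).domRestrict⟩
  have hB : ∀ k x, B k x = F k x := fun k x => rfl
  have hcomp : IsCompact (closure (Set.range B)) := by
    refine BoundedContinuousFunction.arzela_ascoli (closedBall 0 M) (isCompact_closedBall 0 M) _
      ?_ ?_
    · rintro _ x ⟨k, rfl⟩
      simpa [hB] using hM k x (hsub x.2)
    · intro x
      -- The Schwarz lemma on the disk of radius `r/2` about `x` gives a Lipschitz bound independent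
      -- of `k`.
      refine Metric.equicontinuousAt_of_continuity_modulus
        (fun y : closedBall c (r / 2) => 2 * M / (r / 2) * dist (y : ℂ) x) ?_ _ ?_
      · have : Continuous fun y : closedBall c (r / 2) => 2 * M / (r / 2) * dist (y : ℂ) x := by
          fun_prop
        simpa using this.tendsto x
      · filter_upwards [ball_mem_nhds x (half_pos hr)] with y hy
        rintro ⟨_, k, rfl⟩
        have hxr : ball (x : ℂ) (r / 2) ⊆ ball c r :=
          ball_subset_ball' (by linarith [mem_closedBall.1 x.2])
        change dist (F k x) (F k y) ≤ _
        rw [dist_comm]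
        refine Complex.dist_le_div_mul_dist_of_mapsTo_ball ((hF k).mono hxr) ?_ hy
        intro z hz
        rw [mem_closedBall, dist_eq_norm]
        linarith [norm_sub_le (F k z) (F k x), hM k z (hxr hz), hM k x (hsub x.2)]
  obtain ⟨G, -, φ, hφ, hlim⟩ := hcomp.tendsto_subseq (fun k => subset_closure (Set.mem_range_self k))
  have hunif := BoundedContinuousFunction.tendsto_iff_tendstoUniformly.1 hlim
  classical
  let G' : ℂ → ℂ := fun z => if hz : z ∈ closedBall c (r / 2) then G ⟨z, hz⟩ else 0
  have hu : TendstoUniformlyOn (fun k => F (φ k)) G' atTop (closedBall c (r / 2)) := by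
    rw [Metric.tendstoUniformlyOn_iff]
    intro ε hε
    filter_upwards [Metric.tendstoUniformly_iff.1 hunif ε hε] with k hk z hz
    have := hk ⟨z, hz⟩
    simpa only [G', dif_pos hz, Function.comp_apply, hB] using this
  have hloc : TendstoLocallyUniformlyOn (fun k => F (φ k)) G' atTop (ball c (r / 2)) :=
    (hu.mono ball_subset_closedBall).tendstoLocallyUniformlyOn
  refine ⟨φ, hφ, G', hloc.differentiableOn (Eventually.of_forall fun k =>
    (hF _).mono (ball_subset_closedBall.trans hsub)) isOpen_ball, hloc⟩

/-! ### Points where cosh is an odd integer. -/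

/-- For `u ≥ 0`, cosh grows by at least 2 on `[u, u + 2]`, so it passes through an odd integer
there. -/
theorem Real.exists_abs_sub_le_two_cosh_eq (u : ℝ) :
    ∃ t : ℝ, |t - u| ≤ 2 ∧ ∃ n : ℤ, Real.cosh t = 2 * n - 1 := by
  wlog hu : 0 ≤ u generalizing u
  · obtain ⟨t, ht, n, hn⟩ := this (-u) (by linarith)
    refine ⟨-t, ?_, n, by rwa [Real.cosh_neg]⟩
    rwa [← abs_neg, show -(-t - u) = t - -u by ring]
  have h1 : (1 : ℝ) ≤ Real.sinh 1 := Real.self_le_sinh_iff.2 zero_le_one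
  have h2 : 3 ≤ Real.cosh 2 := by
    have h := Real.cosh_two_mul 1
    have h' := Real.cosh_sq 1
    rw [mul_one] at h
    nlinarith
  have h3 : Real.cosh u + 2 ≤ Real.cosh (u + 2) := by
    rw [Real.cosh_add]
    have := Real.one_le_cosh u
    have := mul_nonneg (Real.sinh_nonneg_iff.2 hu) (Real.sinh_nonneg_iff.2 zero_le_two)
    nlinarith
  have h4 := Int.le_ceil ((Real.cosh u + 1) / 2)
  have h5 := Int.ceil_lt_add_one ((Real.cosh u + 1) / 2)
  set n := ⌈(Real.cosh u + 1) / 2⌉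
  obtain ⟨t, ht, htn⟩ := intermediate_value_Icc (show u ≤ u + 2 by linarith)
    Real.continuous_cosh.continuousOn
    (show (2 * n - 1 : ℝ) ∈ Set.Icc (Real.cosh u) (Real.cosh (u + 2)) from
      ⟨by linarith, by linarith⟩)
  exact ⟨t, abs_le.2 ⟨by linarith [ht.1], by linarith [ht.2]⟩, n, htn⟩

open Metric in
/-- The points at which `cosh` takes odd integer values form a relatively dense set. -/
theorem Complex.exists_mem_ball_cosh_eq (w : ℂ) :
    ∃ v ∈ ball w 6, ∃ n : ℤ, Complex.cosh v = 2 * n - 1 := by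
  obtain ⟨t, ht, n, hn⟩ := Real.exists_abs_sub_le_two_cosh_eq w.re
  have hpi := Real.pi_pos
  set m : ℤ := round (w.im / (2 * Real.pi))
  have hm : |w.im - m * (2 * Real.pi)| ≤ Real.pi := by
    have h := abs_sub_round (w.im / (2 * Real.pi))
    have h' : w.im - m * (2 * Real.pi) = (w.im / (2 * Real.pi) - m) * (2 * Real.pi) := by
      field_simp
    rw [h', abs_mul, abs_of_pos (show 0 < 2 * Real.pi by positivity)]
    calc _ ≤ 1 / 2 * (2 * Real.pi) := by gcongr
      _ = Real.pi := by ring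
  refine ⟨t + m * (2 * Real.pi * Complex.I), ?_, n, ?_⟩
  · rw [mem_ball, dist_eq_norm]
    have h := Complex.norm_le_abs_re_add_abs_im (t + m * (2 * Real.pi * Complex.I) - w)
    have hre : ((t : ℂ) + m * (2 * Real.pi * Complex.I) - w).re = t - w.re := by simp
    have him : ((t : ℂ) + m * (2 * Real.pi * Complex.I) - w).im = m * (2 * Real.pi) - w.im := by
      simp
    rw [hre, him, abs_sub_comm _ w.im] at h
    linarith [Real.pi_lt_four]
  · have h1 : Complex.exp (t + m * (2 * Real.pi * Complex.I)) = Complex.exp t := by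
      rw [Complex.exp_add, Complex.exp_int_mul_two_pi_mul_I, mul_one]
    rw [Complex.cosh, Complex.exp_neg, h1, ← Complex.exp_neg, ← Complex.cosh, ← Complex.ofReal_cosh,
      hn]
    push_cast
    ring

theorem Complex.norm_cosh_le_exp_norm (z : ℂ) : ‖Complex.cosh z‖ ≤ Real.exp ‖z‖ := by
  rw [Complex.cosh, norm_div, Complex.norm_ofNat]
  have h1 := Complex.norm_exp_le_exp_norm z
  have h2 := Complex.norm_exp_le_exp_norm (-z)
  rw [norm_neg] at h2
  linarith [norm_add_le (Complex.exp z) (Complex.exp (-z))]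

theorem Complex.abs_re_le_norm_cosh (z : ℂ) : |z.re| ≤ 2 * ‖Complex.cosh z‖ + 1 := by
  wlog hz : 0 ≤ z.re generalizing z
  · simpa using this (-z) (by simpa using (not_le.1 hz).le)
  have h1 : Complex.exp z = 2 * Complex.cosh z - Complex.exp (-z) := by
    rw [Complex.cosh]; ring
  have h2 := norm_sub_le (2 * Complex.cosh z) (Complex.exp (-z))
  rw [← h1, norm_mul, Complex.norm_ofNat, Complex.norm_exp, Complex.norm_exp, Complex.neg_re] at h2
  have h3 : Real.exp (-z.re) ≤ 1 := Real.exp_le_one_iff.2 (by linarith)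
  rw [abs_of_nonneg hz]
  linarith [Real.add_one_le_exp z.re]

/-! ### Schottky's theorem. -/

open Metric in
/-- A holomorphic function on a disk omitting `0` and `1` is of the form `exp (π i (1 + cosh H))`
with `H` holomorphic. -/
theorem exists_exp_cosh_eq {c : ℂ} {r : ℝ} (hr : 0 < r) {F : ℂ → ℂ}
    (hF : DifferentiableOn ℂ F (ball c r)) (h0 : ∀ z ∈ ball c r, F z ≠ 0)
    (h1 : ∀ z ∈ ball c r, F z ≠ 1) :
    ∃ H : ℂ → ℂ, DifferentiableOn ℂ H (ball c r) ∧
      (∀ z ∈ ball c r, Complex.exp (Real.pi * Complex.I * (1 + Complex.cosh (H z))) = F z) ∧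
      ‖H c‖ ≤ 7 + 2 * ‖Complex.log (F c)‖ := by
  have hpi : (Real.pi : ℂ) ≠ 0 := by exact_mod_cast Real.pi_ne_zero
  have hc : c ∈ ball c r := mem_ball_self hr
  obtain ⟨l, hl, hle, hlc⟩ := exists_differentiableOn_exp_eq hr hF h0
  set A : ℂ → ℂ := fun z => l z / (2 * Real.pi * Complex.I) with hA
  have hAd : DifferentiableOn ℂ A (ball c r) := hl.div_const _
  have hlA : ∀ z, l z = 2 * Real.pi * Complex.I * A z := by
    intro z
    simp only [hA]
    field_simp
  have hAint : ∀ z ∈ ball c r, ∀ n : ℤ, A z ≠ n := by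
    intro z hz n hn
    apply h1 z hz
    rw [← hle z hz, hlA, hn, mul_comm, Complex.exp_int_mul_two_pi_mul_I]
  -- As `F = exp (2π i A)` omits 1, `A` omits the integers, so `A (A - 1)` has a holomorphic square
  -- root `S`. Then `2A - 1 ± 2S` are reciprocal, and a logarithm `H` of one of them satisfies `cosh
  -- H = 2A - 1`.
  obtain ⟨s, hs, hse, -⟩ := exists_differentiableOn_exp_eq hr
    (f := fun z => A z * (A z - 1)) (hAd.mul (hAd.sub_const 1)) (fun z hz =>
      mul_ne_zero (by simpa using hAint z hz 0) (sub_ne_zero.2 (by simpa using hAint z hz 1)))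
  set S : ℂ → ℂ := fun z => Complex.exp (s z / 2) with hS
  have hSd : DifferentiableOn ℂ S (ball c r) := (hs.div_const 2).cexp
  have hS2 : ∀ z ∈ ball c r, S z * S z = A z * (A z - 1) := by
    intro z hz
    rw [← hse z hz, hS, ← Complex.exp_add, add_halves]
  have hprod : ∀ z ∈ ball c r, (2 * A z - 1 + 2 * S z) * (2 * A z - 1 - 2 * S z) = 1 := by
    intro z hz
    linear_combination (-4) * hS2 z hz
  obtain ⟨H, hH, hHe, hHc⟩ := exists_differentiableOn_exp_eq hr
    (f := fun z => 2 * A z - 1 + 2 * S z)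
    (((hAd.const_mul 2).sub_const 1).add (hSd.const_mul 2))
    (fun z hz => left_ne_zero_of_mul_eq_one (hprod z hz))
  have hcosh : ∀ z ∈ ball c r, Complex.cosh (H z) = 2 * A z - 1 := by
    intro z hz
    rw [Complex.cosh, Complex.exp_neg, hHe z hz, ← eq_inv_of_mul_eq_one_right (hprod z hz)]
    ring
  refine ⟨H, hH, fun z hz => ?_, ?_⟩
  · rw [hcosh z hz, ← hle z hz, hlA]
    ring_nf
  · have hb1 := Complex.norm_le_abs_re_add_abs_im (H c)
    have hb2 := Complex.abs_re_le_norm_cosh (H c)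
    have hb3 : |(H c).im| ≤ Real.pi := by
      rw [hHc, Complex.log_im]
      exact Complex.abs_arg_le_pi _
    have hb4 : ‖Complex.cosh (H c)‖ ≤ 1 + ‖Complex.log (F c)‖ := by
      have hAc : 2 * A c = Complex.log (F c) / (Real.pi * Complex.I) := by
        rw [← hlc, hlA]
        field_simp
      rw [hcosh c hc, hAc]
      refine (norm_sub_le _ _).trans ?_
      rw [norm_div, norm_mul, Complex.norm_I, mul_one, norm_one, Complex.norm_real,
        Real.norm_of_nonneg Real.pi_pos.le, add_comm]
      gcongr
      exact div_le_self (norm_nonneg _) (by linarith [Real.pi_gt_three])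
    linarith [Real.pi_lt_four]

-- Since `F` omits 1, `cosh H` is never an odd integer, so the image of `H` contains no disk of
-- radius 6. Bloch's theorem then bounds `H'`, and integration from the centre bounds `H`.
open Metric in
theorem norm_le_of_omits_zero_one {c : ℂ} {r : ℝ} (hr : 0 < r) {F : ℂ → ℂ}
    (hF : DifferentiableOn ℂ F (ball c r)) (h0 : ∀ z ∈ ball c r, F z ≠ 0)
    (h1 : ∀ z ∈ ball c r, F z ≠ 1) {z : ℂ} (hz : z ∈ ball c (r / 2)) :
    ‖F z‖ ≤ Real.exp (Real.pi * (1 + Real.exp (583 + 2 * ‖Complex.log (F c)‖))) := by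
  obtain ⟨H, hH, hHF, hHc⟩ := exists_exp_cosh_eq hr hF h0 h1
  have hsub : ball c (r / 2) ⊆ ball c r := ball_subset_ball (by linarith)
  have hder : ∀ w ∈ ball c (r / 2), ‖deriv H w‖ ≤ 1152 / r := by
    intro w hw
    have hwr : ball w (r / 2) ⊆ ball c r := ball_subset_ball' (by linarith [mem_ball.1 hw])
    obtain ⟨p, hp⟩ := exists_ball_subset_image_ball (r := r / 4) (by positivity) (by linarith)
      (hH.mono hwr)
    -- The constant 1152 = 6 · 48 · 4 makes the Bloch disk have radius at least 6. Integrating over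
    -- a length below `r/2` adds 576 to the 7 at the centre, whence 583.
    by_contra! hlt
    have hrad : 6 ≤ ‖deriv H w‖ * (r / 4) / 48 := by
      rw [div_lt_iff₀ hr] at hlt
      linarith
    obtain ⟨v, hv, n, hn⟩ := Complex.exists_mem_ball_cosh_eq p
    obtain ⟨x, hx, rfl⟩ := hp (ball_subset_ball hrad hv)
    apply h1 x (hwr hx)
    rw [← hHF x (hwr hx), hn,
      show Real.pi * Complex.I * (1 + (2 * n - 1)) = n * (2 * Real.pi * Complex.I) by ring,
      Complex.exp_int_mul_two_pi_mul_I]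
  have hHz : ‖H z‖ ≤ 583 + 2 * ‖Complex.log (F c)‖ := by
    have h := (convex_ball c (r / 2)).norm_image_sub_le_of_norm_deriv_le
      (fun w hw => hH.differentiableAt (isOpen_ball.mem_nhds (hsub hw))) hder
      (mem_ball_self (by positivity)) hz
    have h' : 1152 / r * ‖z - c‖ ≤ 576 := by
      rw [mem_ball, dist_eq_norm] at hz
      calc 1152 / r * ‖z - c‖ ≤ 1152 / r * (r / 2) := by gcongr
        _ = 576 := by field_simp; norm_num
    linarith [norm_le_norm_add_norm_sub' (H z) (H c)]
  rw [← hHF z (hsub hz)]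
  refine (Complex.norm_exp_le_exp_norm _).trans (Real.exp_le_exp.2 ?_)
  rw [norm_mul, norm_mul, Complex.norm_I, mul_one, Complex.norm_real,
    Real.norm_of_nonneg Real.pi_pos.le]
  gcongr
  refine (norm_add_le _ _).trans ?_
  rw [norm_one]
  gcongr
  exact (Complex.norm_cosh_le_exp_norm _).trans (Real.exp_le_exp.2 hHz)

theorem Complex.norm_log_le_of_half_le {w : ℂ} {M : ℝ} (h : 1 / 2 ≤ ‖w‖) (hM : ‖w‖ ≤ M) :
    ‖Complex.log w‖ ≤ M + 5 := by
  have hw : 0 < ‖w‖ := by linarith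
  refine (Complex.norm_le_abs_re_add_abs_im _).trans ?_
  rw [Complex.log_re, Complex.log_im]
  have h1 := Complex.abs_arg_le_pi w
  have h2 : |Real.log ‖w‖| ≤ M + 1 := by
    have ha := Real.log_le_sub_one_of_pos hw
    have hb := Real.one_sub_inv_le_log_of_pos hw
    have hc : ‖w‖⁻¹ ≤ 2 := by
      rw [inv_le_comm₀ hw two_pos]
      linarith
    exact abs_le.2 ⟨by linarith, by linarith⟩
  linarith [Real.pi_lt_four]

open Metric in
/-- **Schottky's theorem**. -/
theorem exists_norm_le_of_omits {a b : ℂ} (hab : a ≠ b) (M : ℝ) :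
    ∃ K : ℝ, ∀ (c : ℂ) (r : ℝ) (F : ℂ → ℂ), 0 < r → DifferentiableOn ℂ F (ball c r) →
      (∀ z ∈ ball c r, F z ≠ a ∧ F z ≠ b) → ‖F c‖ ≤ M → ∀ z ∈ ball c (r / 2), ‖F z‖ ≤ K := by
  have hba : b - a ≠ 0 := sub_ne_zero.2 hab.symm
  set N : ℝ := (M + ‖a‖) / ‖b - a‖ with hN
  set Q : ℝ := Real.exp (Real.pi * (1 + Real.exp (583 + 2 * (N + 1 + 5)))) with hQ
  refine ⟨‖b - a‖ * (Q + 1) + ‖a‖, fun c r F hr hF ho hM z hz => ?_⟩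
  have hbound : ∀ w : ℂ, 1 / 2 ≤ ‖w‖ → ‖w‖ ≤ N + 1 →
      Real.exp (Real.pi * (1 + Real.exp (583 + 2 * ‖Complex.log w‖))) ≤ Q := by
    intro w h1 h2
    have := Complex.norm_log_le_of_half_le h1 h2
    rw [hQ]
    gcongr
  set f : ℂ → ℂ := fun z => (F z - a) / (b - a) with hf
  have hfd : DifferentiableOn ℂ f (ball c r) := (hF.sub_const a).div_const _
  have hf0 : ∀ w ∈ ball c r, f w ≠ 0 := fun w hw =>
    div_ne_zero (sub_ne_zero.2 (ho w hw).1) hba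
  have hf1 : ∀ w ∈ ball c r, f w ≠ 1 := fun w hw h => by
    rw [hf, div_eq_one_iff_eq hba, sub_left_inj] at h
    exact (ho w hw).2 h
  have hfc : ‖f c‖ ≤ N := by
    rw [hf, hN, norm_div]
    gcongr
    exact (norm_sub_le _ _).trans (by gcongr)
  have hfz : ‖f z‖ ≤ Q + 1 := by
    -- The bound degenerates as `f c` approaches 0; in that case `1 - f`, which also omits 0 and 1,
    -- has modulus at least 1/2 at `c`.
    by_cases hlow : 1 / 2 ≤ ‖f c‖
    · have h1 := norm_le_of_omits_zero_one hr hfd hf0 hf1 hz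
      linarith [hbound (f c) hlow (by linarith)]
    · have h1 := norm_le_of_omits_zero_one hr (F := fun w => 1 - f w) (hfd.const_sub 1)
        (fun w hw => sub_ne_zero.2 (hf1 w hw).symm) (fun w hw h => hf0 w hw (by simpa using h)) hz
      have h2 := norm_sub_norm_le 1 (f c)
      have h3 := norm_sub_le 1 (f c)
      rw [norm_one] at h2 h3
      have h4 := hbound (1 - f c) (by linarith) (by linarith)
      have h5 := norm_sub_norm_le (f z) 1
      rw [norm_sub_rev, norm_one] at h5
      linarith
  have hFz : F z = (b - a) * f z + a := by
    simp only [hf]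
    field_simp
    ring
  rw [hFz]
  refine (norm_add_le _ _).trans ?_
  rw [norm_mul]
  gcongr

/-! ### Montel's normality test. -/

open Metric in
/-- **Montel's fundamental normality test** on a disk. -/
theorem exists_subseq_of_omits {a b : ℂ} (hab : a ≠ b) {c : ℂ} {r : ℝ} (hr : 0 < r)
    {F : ℕ → ℂ → ℂ} (hF : ∀ k, DifferentiableOn ℂ (F k) (ball c r))
    (ho : ∀ k, ∀ z ∈ ball c r, F k z ≠ a ∧ F k z ≠ b) :
    ∃ φ : ℕ → ℕ, StrictMono φ ∧
      ((∃ G : ℂ → ℂ, DifferentiableOn ℂ G (ball c (r / 4)) ∧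
        TendstoLocallyUniformlyOn (fun k => F (φ k)) G atTop (ball c (r / 4))) ∨
      TendstoInftyLocallyUniformlyOn (fun k => F (φ k)) (ball c (r / 4))) := by
  by_cases hbdd : ∃ M : ℝ, ∃ᶠ k in atTop, ‖F k c‖ ≤ M
  · obtain ⟨M, hM⟩ := hbdd
    obtain ⟨φ, hφ, hφM⟩ := extraction_of_frequently_atTop hM
    obtain ⟨K, hK⟩ := exists_norm_le_of_omits hab M
    obtain ⟨ψ, hψ, G, hG, hlim⟩ := exists_subseq_tendstoLocallyUniformlyOn_of_bounded
      (F := fun k => F (φ k)) (half_pos hr)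
      (fun k => (hF _).mono (ball_subset_ball (by linarith)))
      (fun k z hz => hK c r _ hr (hF _) (ho _) (hφM k) z hz)
    have he : r / 2 / 2 = r / 4 := by ring
    rw [he] at hG hlim
    exact ⟨φ ∘ ψ, hφ.comp hψ, Or.inl ⟨G, hG, hlim⟩⟩
  · push Not at hbdd
    refine ⟨id, strictMono_id, Or.inr fun K hK _ R => ?_⟩
    -- If `‖F k z‖ ≤ R`, Schottky's theorem centred at `z` bounds `F k c` by `B`, contrary to the
    -- divergence at `c`.
    obtain ⟨B, hB⟩ := exists_norm_le_of_omits hab R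
    filter_upwards [hbdd B] with k hk z hz
    by_contra! hle
    have hzc := mem_ball.1 (hK hz)
    have hsub : ball z (r / 2) ⊆ ball c r := ball_subset_ball' (by linarith)
    have := hB z (r / 2) (F k) (by positivity) ((hF k).mono hsub) (fun w hw => ho k w (hsub hw))
      hle c (by rw [mem_ball, dist_comm]; linarith)
    linarith

/-! ### Transfer of normality through the semiconjugacy. -/

/-- Postcomposition with a continuous map preserves locally uniform convergence to a continuous
limit. -/
theorem TendstoLocallyUniformlyOn.continuous_comp_left {X Y Z ι : Type*} [TopologicalSpace X]
    [UniformSpace Y] [UniformSpace Z] {F : ι → X → Y} {G : X → Y} {l : Filter ι} {s : Set X}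
    {f : Y → Z} (h : TendstoLocallyUniformlyOn F G l s) (hG : ContinuousOn G s)
    (hf : Continuous f) : TendstoLocallyUniformlyOn (fun i => f ∘ F i) (f ∘ G) l s := by
  rw [tendstoLocallyUniformlyOn_iff_forall_tendsto] at h ⊢
  intro x hx
  -- Both `G y` and `F i y` tend to the single point `G x`, so continuity of `f` there replaces
  -- uniform continuity.
  have h1 : Tendsto (fun y : ι × X => G y.2) (l ×ˢ 𝓝[s] x) (𝓝 (G x)) :=
    (hG x hx).tendsto.comp tendsto_snd
  have h2 := (Uniform.tendsto_congr (h x hx)).1 h1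
  exact (((hf.tendsto _).comp h1).prodMk_nhds ((hf.tendsto _).comp h2)).mono_right
    (nhds_le_uniformity (f (G x)))

open Metric in
theorem mainTheorem3 (f g h : ℂ → ℂ)
    (hg : IsTranscendentalEntire g) (hh : IsTranscendentalEntire h)
    (hf_cont : Continuous f) (hf_open : IsOpenMap f)
    (hsemi : f ∘ g = h ∘ f)
    (hf_omit : OmitsTwoValuesOutsideDisks f) :
    f '' fatouSet g ⊆ fatouSet h := by
  rintro _ ⟨z, ⟨U, hUo, -, hzU, hnorm⟩, rfl⟩
  obtain ⟨a, b, hab, hom⟩ := hf_omit 0 1 one_pos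
  have hiter : ∀ n x, h^[n] (f x) = f (g^[n] x) := fun n x =>
    ((Function.Semiconj.iterate_right (f := f) (ga := g) (gb := h)
      (fun x => congrFun hsemi x) n) x).symm
  have hhd : ∀ n, Differentiable ℂ h^[n] := fun n => hh.entire.iterate n
  obtain ⟨ε, hε, hεU⟩ := nhds_basis_closedBall.mem_iff.1 (hUo.mem_nhds hzU)
  obtain ⟨r, hr, hrV⟩ := Metric.mem_nhds_iff.1
    ((hf_open _ isOpen_ball).mem_nhds (Set.mem_image_of_mem f (mem_ball_self (x := z) hε)))
  have hr4 : ball (f z) (r / 4) ⊆ ball (f z) r := ball_subset_ball (by linarith)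
  refine ⟨ball (f z) (r / 4), isOpen_ball,
    ((convex_ball _ _).isConnected ⟨f z, mem_ball_self (by positivity)⟩),
    mem_ball_self (by positivity), fun s => ?_⟩
  obtain ⟨φ, hφ, ⟨G, hG, hlim⟩ | hinf⟩ := hnorm s
  · refine ⟨φ, hφ, Or.inl ?_⟩
    -- The section `q` of `f` need not be continuous: convergence is uniform on the closed disk, and
    -- the limit is holomorphic as a locally uniform limit of iterates of `h`.
    obtain ⟨q, hq⟩ : ∃ q : ℂ → ℂ, ∀ w ∈ ball (f z) r, q w ∈ ball z ε ∧ f (q w) = w := by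
      choose! q hq using hrV
      exact ⟨q, hq⟩
    have hcomp : TendstoLocallyUniformlyOn (fun k => f ∘ g^[s (φ k)]) (f ∘ G) atTop U :=
      hlim.continuous_comp_left hG.continuousOn hf_cont
    have hunif : TendstoUniformlyOn (fun k => f ∘ g^[s (φ k)]) (f ∘ G) atTop (closedBall z ε) :=
      (tendstoLocallyUniformlyOn_iff_tendstoUniformlyOn_of_compact
        (isCompact_closedBall z ε)).1 (hcomp.mono hεU)
    have hlim' : TendstoLocallyUniformlyOn (fun k => h^[s (φ k)]) (fun w => f (G (q w))) atTop
        (ball (f z) (r / 4)) := by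
      refine TendstoUniformlyOn.tendstoLocallyUniformlyOn ?_
      rw [Metric.tendstoUniformlyOn_iff] at hunif ⊢
      intro δ hδ
      filter_upwards [hunif δ hδ] with k hk w hw
      obtain ⟨h1, h2⟩ := hq w (hr4 hw)
      have := hk (q w) (ball_subset_closedBall h1)
      rwa [Function.comp_apply, Function.comp_apply, ← hiter, h2] at this
    exact ⟨_, hlim'.differentiableOn (Eventually.of_forall fun k =>
      (hhd _).differentiableOn) isOpen_ball, hlim'⟩
  · obtain ⟨k₀, hk₀⟩ := eventually_atTop.1 (hinf _ hεU (isCompact_closedBall z ε) 1)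
    obtain ⟨ψ, hψ, hψlim⟩ := exists_subseq_of_omits hab hr
      (F := fun k => h^[s (φ (k + k₀))]) (fun k => (hhd _).differentiableOn) (by
        intro k w hw
        obtain ⟨x, hx, rfl⟩ := hrV hw
        rw [hiter]
        refine hom _ fun hmem => ?_
        have h1 := hk₀ (k + k₀) (by omega) x (ball_subset_closedBall hx)
        have h2 := closure_ball_subset_closedBall hmem
        rw [mem_closedBall_zero_iff] at h2
        linarith)
    exact ⟨fun k => φ (ψ k + k₀), fun i j hij => hφ (by have := hψ hij; omega), hψlim⟩
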